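/- Write $\mathrm{ex}(n,C_4)$ for the largest number of edges of a simple graph on $n$ vertices that contains no cycle of length $4$ as a subgraph (such a graph is called $C_4$-free). A polarity of a finite projective plane with point set $P$ and line set $L$ is an involutory permutation $\phi$ of the disjoint union $P\cup L$ that maps points to lines and lines to points and reverses containment. A point is absolute if it lies on its own image under $\phi$, and a polarity of a plane of order $q$ is orthogonal if it has exactly $q+1$ absolute points. The polarity graph of $\phi$ has vertex set $P$, two distinct points $x,y$ being adjacent if and only if $x\in\phi(y)$; it is called an orthogonal polarity graph if $\phi$ is orthogonal. Then the following hold. (1) For every even natural number $q$, every $C_4$-free graph on $q^2+q$ vertices has at most $\frac12 q(q+1)^2-q$ edges, that is, $\mathrm{ex}(q^2+q,C_4)\le \frac12 q(q+1)^2-q$. (2) If $G$ is an orthogonal polarity graph of a projective plane of order $q$ and $v$ is a vertex of minimum degree in $G$, then $G-v$ is a $C_4$-free graph on $q^2+q$ vertices with exactly $\frac12 q(q+1)^2-q$ edges. In particular, if $q$ is even, $G-v$ has $\mathrm{ex}(q^2+q,C_4)$ edges. (3) If $q=2^k$ for some integer $k\ge 0$, then $\mathrm{ex}(q^2+q,C_4)=\frac12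 q(q+1)^2-q$. -/

import Mathlib

/-- A polarity of an incidence structure with points `P` and lines `L`: an involution of the
disjoint union of `P` and `L` that interchanges points and lines and reverses containment.
Such an involution is given by the bijection `toLine` it induces from points to lines; on lines
it is the inverse bijection `toLine.symm`. -/
structure Polarity (P L : Type*) [Membership P L] where
  /-- The line that is the image of a point. -/
  toLine : P ≃ L
  /-- A point lies on a line iff the image of the line lies on the image of the point. -/
  mem_iff : ∀ (p : P) (l : L), p ∈ l ↔ toLine.symm l ∈ toLine p

namespace Polarity

variable {P L : Type*} [Membership P L]

/-- A point is absolute if it lies on its own polar line. -/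
def IsAbsolute (φ : Polarity P L) (p : P) : Prop :=
  p ∈ φ.toLine p

/-- A polarity of a projective plane of order `q` is orthogonal if it has exactly `q + 1`
absolute points. -/
def IsOrthogonal [Configuration.ProjectivePlane P L] (φ : Polarity P L) : Prop :=
  {p : P | φ.IsAbsolute p}.ncard = Configuration.ProjectivePlane.order P L + 1

/-- The polarity graph: its vertices are the points, and two distinct points `x`, `y` are adjacent
iff `x` lies on the polar line of `y`. -/
def graph (φ : Polarity P L) : SimpleGraph P where
  Adj x y := x ≠ y ∧ x ∈ φ.toLine y
  symm := ⟨fun x y h => ⟨h.1.symm, by simpa using (φ.mem_iff x (φ.toLine y)).1 h.2⟩⟩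
  loopless := ⟨fun _ h => h.1 rfl⟩

end Polarity

/-! Suppose a `C₄`-free graph on `q² + q` vertices, `q` even, beats the bound. Counting pairs
outside a neighbourhood shows that degrees are at most `q + 2` and that the set `A` of vertices of
degree `q + 2` is small (`degree_le`, `card_degree_eq_le`). Let `B` be the vertices of degree at
most `q`. Every other vertex has odd degree `q + 1`, and parity saves one in its
second-neighbourhood count. Summing the deficiencies `q + 1 - d(w)` over adjacent pairs in two ways
then forces many incidences between `A` and `B`, more than Cauchy–Schwarz allows
(`incidence_bounds_contradiction`).

For sharpness, an orthogonal polarity graph has `q(q + 1)²/2` edges and minimum degree `q`. Over a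
field of order `2 ^ k`, `k ≥ 1`, the dot product gives such a polarity. -/

namespace SimpleGraph

/-- Two distinct vertices have at most one common neighbour. -/
def AtMostOneCommonNeighbor {V : Type*} (G : SimpleGraph V) : Prop :=
  ∀ ⦃s t a b : V⦄, s ≠ t → G.Adj a s → G.Adj a t → G.Adj b s → G.Adj b t → a = b

theorem cycleGraph_four_free_iff {V : Type*} (G : SimpleGraph V) :
    (cycleGraph 4).Free G ↔ G.AtMostOneCommonNeighbor := by
  constructor
  · intro h s t a b hst has hat hbs hbt
    by_contra hab
    refine h ⟨⟨⟨![s, a, t, b], ?_⟩, ?_⟩⟩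
    · intro i j hij
      have := has.ne
      have := hat.ne
      have := hbs.ne
      have := hbt.ne
      fin_cases i <;> fin_cases j <;>
        simp [cycleGraph_adj, has, hat, hbs, hbt, has.symm, hat.symm, hbs.symm, hbt.symm] at hij ⊢ <;>
        exact absurd hij (by decide)
    · intro i j hij
      have := has.ne
      have := hat.ne
      have := hbs.ne
      have := hbt.ne
      fin_cases i <;> fin_cases j <;> simp_all
  · rintro h ⟨f⟩
    have adj : ∀ i j : Fin 4, (cycleGraph 4).Adj i j → G.Adj (f i) (f j) :=
      fun i j hij => f.toHom.map_adj hij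
    have h02 : f 0 ≠ f 2 := fun e => absurd (f.injective e) (by decide)
    have h13 : f 1 ≠ f 3 := fun e => absurd (f.injective e) (by decide)
    exact h13 (h h02 (adj 1 0 (by decide)) (adj 1 2 (by decide)) (adj 3 0 (by decide))
      (adj 3 2 (by decide)))

/-! ### Counting in graphs without 4-cycles. -/

section

variable {V : Type*} [Fintype V] [DecidableEq V] {G : SimpleGraph V} [DecidableRel G.Adj]

/-- An ordered pair of distinct vertices of `W` lies in the neighbourhood of at most one `y`. -/
theorem AtMostOneCommonNeighbor.sum_pairs_le (h : G.AtMostOneCommonNeighbor) (Y W : Finset V) :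
    ∑ y ∈ Y, (((G.neighborFinset y ∩ W).card : ℤ) * ((G.neighborFinset y ∩ W).card - 1)) ≤
      (W.card : ℤ) * (W.card - 1) := by
  have key (s : Finset V) : (s.offDiag.card : ℤ) = (s.card : ℤ) * (s.card - 1) := by
    rw [Finset.offDiag_card, Nat.cast_sub (Nat.le_mul_self _)]
    push_cast
    ring
  simp_rw [← key]
  rw [← Nat.cast_sum, ← Finset.card_biUnion]
  · refine Nat.cast_le.2 (Finset.card_le_card ?_)
    intro p hp
    simp only [Finset.mem_biUnion, Finset.mem_offDiag, Finset.mem_inter] at hp ⊢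
    obtain ⟨y, -, h1, h2, h3⟩ := hp
    exact ⟨h1.2, h2.2, h3⟩
  · intro a _ b _ hab
    rw [Function.onFun, Finset.disjoint_left]
    rintro p hp hq
    simp only [Finset.mem_offDiag, Finset.mem_inter, mem_neighborFinset] at hp hq
    exact hab (h hp.2.2 hp.1.1 hp.2.1.1 hq.1.1 hq.2.1.1)

omit [DecidableEq V] in
/-- A vertex of odd degree has a neighbour with which it shares no neighbour. -/
theorem AtMostOneCommonNeighbor.exists_adj_of_odd_degree (h : G.AtMostOneCommonNeighbor) {v : V}
    (hv : Odd (G.degree v)) : ∃ z, G.Adj v z ∧ ∀ w, G.Adj v w → ¬ G.Adj w z := by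
  by_contra! hc
  -- Otherwise the graph induced on the neighbours of `v` is 1-regular on an odd number of vertices.
  have hdeg : ∀ z : G.neighborSet v, (G.induce (G.neighborSet v)).degree z = 1 := by
    rintro ⟨z, hz⟩
    rw [degree_eq_one_iff_existsUnique_adj]
    obtain ⟨w, hw, hwz⟩ := hc z hz
    refine ⟨⟨w, hw⟩, hwz.symm, ?_⟩
    rintro ⟨w', hw'⟩ hzw
    have hzw' : G.Adj z w' := hzw
    exact Subtype.ext (h hz.ne hw'.symm hzw'.symm hw.symm hwz)
  have hsum := (G.induce (G.neighborSet v)).sum_degrees_eq_twice_card_edges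
  simp only [hdeg, Finset.sum_const, Finset.card_univ, smul_eq_mul, mul_one,
    card_neighborSet_eq_degree] at hsum
  rw [hsum] at hv
  exact (Nat.not_odd_iff_even.2 (even_two_mul _)) hv

/-- For neighbours `w` of `v`, the sets `N(w) \ {v}` are pairwise disjoint: a common element would
close a 4-cycle through `v`. -/
theorem AtMostOneCommonNeighbor.sum_degree_sub_one_le_card (h : G.AtMostOneCommonNeighbor) (v : V)
    (S : Finset V) (hS : ∀ w, G.Adj v w → (G.neighborFinset w).erase v ⊆ S) :
    ∑ w ∈ G.neighborFinset v, ((G.degree w : ℤ) - 1) ≤ S.card := by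
  have key : ∀ w ∈ G.neighborFinset v,
      (G.degree w : ℤ) - 1 = ((G.neighborFinset w).erase v).card := by
    intro w hw
    rw [mem_neighborFinset] at hw
    rw [Finset.cast_card_erase_of_mem (by simpa using hw.symm), card_neighborFinset_eq_degree]
  rw [Finset.sum_congr rfl key, ← Nat.cast_sum, ← Finset.card_biUnion]
  · refine Nat.cast_le.2 (Finset.card_le_card (Finset.biUnion_subset.2 fun w hw => hS w ?_))
    simpa using hw
  · intro a ha b hb hab
    rw [Function.onFun, Finset.disjoint_left]
    intro p hp hq
    simp only [Finset.mem_erase, mem_neighborFinset, Finset.mem_coe] at ha hb hp hq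
    exact hab (h hp.1 hp.2 ha.symm hq.2 hb.symm)

theorem AtMostOneCommonNeighbor.sum_degree_sub_one_le (h : G.AtMostOneCommonNeighbor) (v : V) :
    ∑ w ∈ G.neighborFinset v, ((G.degree w : ℤ) - 1) ≤ Fintype.card V - 1 := by
  refine (h.sum_degree_sub_one_le_card v (Finset.univ.erase v) fun w _ =>
    Finset.erase_subset_erase _ (Finset.subset_univ _)).trans_eq ?_
  rw [Finset.cast_card_erase_of_mem (Finset.mem_univ _), Finset.card_univ]

theorem AtMostOneCommonNeighbor.sum_degree_sub_one_le_of_odd (h : G.AtMostOneCommonNeighbor)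
    {v : V} (hv : Odd (G.degree v)) :
    ∑ w ∈ G.neighborFinset v, ((G.degree w : ℤ) - 1) ≤ Fintype.card V - 2 := by
  obtain ⟨z, hz, hz'⟩ := h.exists_adj_of_odd_degree hv
  refine (h.sum_degree_sub_one_le_card v ((Finset.univ.erase v).erase z) fun w hw => ?_).trans_eq ?_
  · intro u hu
    simp only [Finset.mem_erase, mem_neighborFinset, Finset.mem_univ, and_true] at hu ⊢
    exact ⟨fun e => hz' w hw (e ▸ hu.2), hu.1⟩
  · rw [Finset.cast_card_erase_of_mem (by simp [hz.ne']),
      Finset.cast_card_erase_of_mem (Finset.mem_univ _), Finset.card_univ]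
    ring

/-- The pairs of vertices outside the neighbourhood of `x` are covered by the other vertices. -/
theorem AtMostOneCommonNeighbor.sum_tangent_le (h : G.AtMostOneCommonNeighbor) {q : ℤ}
    (hq : 1 ≤ q) (x : V) (A : Finset V) (hA : ∀ y ∈ A, (G.degree y : ℤ) = q + 2) :
    2 * (q - 1) * (2 * G.edgeFinset.card - G.degree x - (Fintype.card V - 1)) -
      (Fintype.card V - 1) * (q * (q - 1)) + 2 * (A.erase x).card ≤
      (Fintype.card V - G.degree x) * (Fintype.card V - G.degree x - 1 : ℤ) := by
  have hW : ((G.neighborFinset x)ᶜ.card : ℤ) = Fintype.card V - G.degree x := by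
    rw [Finset.card_compl, card_neighborFinset_eq_degree, Nat.cast_sub (G.degree_lt_card_verts x).le]
  have main := h.sum_pairs_le (Finset.univ.erase x) (G.neighborFinset x)ᶜ
  rw [hW] at main
  refine le_trans ?_ main
  -- For integers `c`, `c(c - 1)` is at least the linear function agreeing with it at `q - 1` and
  -- `q`. Here `c ≥ d(y) - 1`, since `y` shares at most one neighbour with `x`; `d(y) = q + 2` gives
  -- `c ≥ q + 1`, hence a gain of 2.
  have pointwise : ∀ y ∈ Finset.univ.erase x,
      2 * (q - 1) * ((G.degree y : ℤ) - 1) - q * (q - 1) + 2 * (if y ∈ A then 1 else 0) ≤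
      ((G.neighborFinset y ∩ (G.neighborFinset x)ᶜ).card : ℤ) *
        ((G.neighborFinset y ∩ (G.neighborFinset x)ᶜ).card - 1) := by
    intro y hy
    have hyx : y ≠ x := (Finset.mem_erase.1 hy).1
    have h1 : (G.neighborFinset y ∩ G.neighborFinset x).card ≤ 1 := by
      refine Finset.card_le_one.2 fun a ha b hb => ?_
      simp only [Finset.mem_inter, mem_neighborFinset] at ha hb
      exact h hyx ha.1.symm ha.2.symm hb.1.symm hb.2.symm
    have h2 : (G.neighborFinset y ∩ (G.neighborFinset x)ᶜ).card +
        (G.neighborFinset y ∩ G.neighborFinset x).card = G.degree y := by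
      rw [← Finset.sdiff_eq_inter_compl, Finset.card_sdiff_add_card_inter,
        card_neighborFinset_eq_degree]
    generalize (G.neighborFinset y ∩ (G.neighborFinset x)ᶜ).card = c at *
    have hc : (G.degree y : ℤ) - 1 ≤ c := by omega
    split_ifs with hyA
    · have := hA y hyA
      rw [this] at hc ⊢
      nlinarith
    · have h3 : 0 ≤ ((c : ℤ) - q) * (c - (q - 1)) := by
        rcases le_or_gt q c with h | h
        · exact mul_nonneg (by omega) (by omega)
        · exact mul_nonneg_of_nonpos_of_nonpos (by omega) (by omega)
      nlinarith [mul_le_mul_of_nonneg_left hc (show 0 ≤ 2 * (q - 1) by omega)]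
  refine le_trans ?_ (Finset.sum_le_sum pointwise)
  rw [Finset.sum_add_distrib, Finset.sum_sub_distrib, ← Finset.mul_sum, ← Finset.mul_sum,
    ← Finset.mul_sum, Finset.sum_sub_distrib, Finset.sum_const, Finset.sum_const, nsmul_eq_mul, nsmul_eq_mul,
    Finset.cast_card_erase_of_mem (Finset.mem_univ x), Finset.card_univ, mul_one]
  have h4 : ∑ y ∈ Finset.univ.erase x, (G.degree y : ℤ) = 2 * G.edgeFinset.card - G.degree x := by
    rw [eq_sub_iff_add_eq, Finset.sum_erase_add _ _ (Finset.mem_univ x)]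
    exact_mod_cast G.sum_degrees_eq_twice_card_edges
  have h5 : ∑ y ∈ Finset.univ.erase x, (if y ∈ A then 1 else 0 : ℤ) = (A.erase x).card := by
    rw [← Finset.sum_filter, Finset.sum_const, nsmul_eq_mul, mul_one, Finset.filter_mem_eq_inter,
      Finset.erase_inter, Finset.univ_inter]
  rw [h4, h5]
  linarith

/-- Incidences between `A` and `B`, by Cauchy–Schwarz. -/
theorem AtMostOneCommonNeighbor.sq_incidences_le (h : G.AtMostOneCommonNeighbor) (A B : Finset V) :
    (∑ w ∈ B, ((G.neighborFinset w ∩ A).card : ℤ)) ^ 2 ≤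
      B.card * (A.card * (A.card - 1) + ∑ w ∈ B, ((G.neighborFinset w ∩ A).card : ℤ)) := by
  refine sq_sum_le_card_mul_sum_sq.trans (mul_le_mul_of_nonneg_left ?_ (Int.natCast_nonneg _))
  have := h.sum_pairs_le B A
  simp only [mul_sub, mul_one, Finset.sum_sub_distrib] at this ⊢
  simp only [sq]
  linarith

omit [DecidableEq V] in
theorem sum_sum_neighborFinset (f : V → ℤ) :
    ∑ v, ∑ w ∈ G.neighborFinset v, f w = ∑ w, (G.degree w : ℤ) * f w := by
  simp_rw [neighborFinset_eq_filter, Finset.sum_filter]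
  rw [Finset.sum_comm]
  refine Finset.sum_congr rfl fun w _ => ?_
  rw [← Finset.sum_filter, Finset.sum_const, nsmul_eq_mul, ← card_neighborFinset_eq_degree,
    neighborFinset_eq_filter]
  simp_rw [G.adj_comm]

theorem sum_card_neighborFinset_inter_le (A B : Finset V) {k : ℤ}
    (hA : ∀ v ∈ A, (G.degree v : ℤ) ≤ k) :
    ∑ w ∈ B, ((G.neighborFinset w ∩ A).card : ℤ) ≤ A.card * k := by
  have h1 : ∑ w ∈ B, ((G.neighborFinset w ∩ A).card : ℤ) ≤
      ∑ w, ∑ v ∈ G.neighborFinset w, (if v ∈ A then 1 else 0 : ℤ) := by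
    simp_rw [← Finset.sum_filter, Finset.filter_mem_eq_inter, Finset.sum_const, nsmul_eq_mul,
      mul_one]
    exact Finset.sum_le_sum_of_subset_of_nonneg (Finset.subset_univ _) fun _ _ _ =>
      Int.natCast_nonneg _
  refine h1.trans ?_
  rw [sum_sum_neighborFinset]
  simp_rw [mul_ite, mul_one, mul_zero]
  rw [← Finset.sum_filter, Finset.filter_mem_eq_inter, Finset.univ_inter, ← nsmul_eq_mul]
  exact Finset.sum_le_card_nsmul _ _ _ hA

/-! ### The upper bound for even `q`. -/

/-- A graph of large size on `q ^ 2 + q` vertices has maximum degree at most `q + 2`. -/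
theorem AtMostOneCommonNeighbor.degree_le (h : G.AtMostOneCommonNeighbor) {q : ℤ} (hq : 2 ≤ q)
    (hn : (Fintype.card V : ℤ) = q ^ 2 + q)
    (he : q * (q + 1) ^ 2 - 2 * q + 2 ≤ 2 * G.edgeFinset.card) (x : V) :
    (G.degree x : ℤ) ≤ q + 2 := by
  by_contra! hx
  have h1 := h.sum_tangent_le (by omega : 1 ≤ q) x ∅ (by simp)
  have h2 : (G.degree x : ℤ) ≤ q ^ 2 + q - 1 := by
    have := G.degree_lt_card_verts x
    omega
  rw [hn, Finset.erase_empty, Finset.card_empty] at h1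
  obtain ⟨t, ht⟩ : ∃ t : ℤ, (G.degree x : ℤ) = q + 3 + t := ⟨_, (add_sub_cancel _ _).symm⟩
  rw [ht] at h1 h2 hx
  have h3 := mul_le_mul_of_nonneg_left he (show 0 ≤ 2 * (q - 1) by omega)
  have h4 : 0 ≤ -q ^ 2 - 5 * q + 12 + t * (t - 2 * q ^ 2 + 2 * q + 5) := by linarith
  have h5 : 0 ≤ t := by omega
  have h6 : t ≤ q ^ 2 - 4 := by linarith
  rcases hq.eq_or_lt with rfl | hq
  · obtain rfl : t = 0 := by omega
    norm_num at h4
  · have h7 : t - 2 * q ^ 2 + 2 * q + 5 ≤ 0 := by nlinarith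
    nlinarith [mul_nonpos_of_nonneg_of_nonpos h5 h7]

/-- In a graph of large size on `q ^ 2 + q` vertices, few vertices have degree `q + 2`. -/
theorem AtMostOneCommonNeighbor.card_degree_eq_le (h : G.AtMostOneCommonNeighbor) {q : ℤ}
    (hq : 1 ≤ q) (hn : (Fintype.card V : ℤ) = q ^ 2 + q)
    (he : q * (q + 1) ^ 2 - 2 * q + 2 ≤ 2 * G.edgeFinset.card) {A : Finset V}
    (hA : ∀ y ∈ A, (G.degree y : ℤ) = q + 2) (hne : A.Nonempty) :
    2 * ((A.card : ℤ) - 1) ≤ q ^ 2 - 7 * q + 8 := by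
  obtain ⟨x, hx⟩ := hne
  have h1 := h.sum_tangent_le hq x A hA
  rw [hn, hA x hx, Finset.cast_card_erase_of_mem hx] at h1
  linarith [mul_le_mul_of_nonneg_left he (show 0 ≤ 2 * (q - 1) by omega)]

/-- The numerical contradiction between the lower and upper bounds on the number `I` of
incidences between the `a` vertices of degree `q + 2` and the `b` vertices of degree at most `q`. -/
theorem incidence_bounds_contradiction {q a b I : ℤ} (hq : 2 ≤ q) (ha : 0 ≤ a)
    (haq : 0 < a → 2 * (a - 1) ≤ q ^ 2 - 7 * q + 8) (hb : b ≤ 2 * q - 2 + a)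
    (hI : (q - 1) * a + 4 ≤ I) (hI' : I ≤ a * (q + 2)) (hsq : I ^ 2 ≤ b * (a * (a - 1) + I)) :
    False := by
  rcases lt_or_ge a 2 with h | h
  · obtain rfl | rfl : a = 0 ∨ a = 1 := by omega
    · linarith
    · linarith
  · replace haq := haq (by omega)
    have hq6 : 6 ≤ q := by nlinarith
    have h1 : 0 ≤ (2 * q - 2 + a - b) * (a * (a - 1) + I) :=
      mul_nonneg (by omega) (by nlinarith)
    have h2 : 0 ≤ (q - 2) * a - 2 * q + 6 := by nlinarith
    have h3 : ((q - 1) * a + 4) * ((q - 2) * a - 2 * q + 6) ≤ I * (I - (2 * q - 2 + a)) :=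
      mul_le_mul hI (by linarith) h2 (by nlinarith)
    have h4 : 0 ≤ q ^ 2 - 5 * q + 3 - a := by nlinarith
    -- This product plus 4 equals the left side of `h3` minus `(2q - 2 + a) * a * (a - 1)`, which
    -- `hsq` and `h1` make nonpositive.
    have h5 : 0 ≤ (a - 2) * (a * (q ^ 2 - 5 * q + 3 - a) + (4 * q - 10)) :=
      mul_nonneg (by omega) (add_nonneg (mul_nonneg ha h4) (by omega))
    linarith

/-- For even `q`, a graph on `q ^ 2 + q` vertices without `4`-cycles has at most
`q * (q + 1) ^ 2 / 2 - q` edges. -/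
theorem AtMostOneCommonNeighbor.two_mul_card_edgeFinset_le (h : G.AtMostOneCommonNeighbor) {q : ℤ}
    (hq : 2 ≤ q) (hqe : Even q) (hn : (Fintype.card V : ℤ) = q ^ 2 + q) :
    2 * (G.edgeFinset.card : ℤ) ≤ q * (q + 1) ^ 2 - 2 * q := by
  by_contra! hlt
  -- Both sides are even, so the strict inequality gains 2.
  have he : q * (q + 1) ^ 2 - 2 * q + 2 ≤ 2 * (G.edgeFinset.card : ℤ) := by
    obtain ⟨r, rfl⟩ := hqe
    have : (r + r) * (r + r + 1) ^ 2 - 2 * (r + r) =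
      2 * (r * (r + r + 1) ^ 2 - 2 * r) := by ring
    omega
  have hΔ := h.degree_le hq hn he
  set A : Finset V := {v | (G.degree v : ℤ) = q + 2} with hA
  set B : Finset V := {v | (G.degree v : ℤ) ≤ q} with hB
  have memA : ∀ v, v ∈ A ↔ (G.degree v : ℤ) = q + 2 := by simp [hA]
  have memB : ∀ v, v ∈ B ↔ (G.degree v : ℤ) ≤ q := by simp [hB]
  have hsum : ∑ v, (G.degree v : ℤ) = 2 * G.edgeFinset.card := by
    exact_mod_cast G.sum_degrees_eq_twice_card_edges
  have cardA : ∑ v, (if v ∈ A then 1 else 0 : ℤ) = A.card := by simp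
  have cardB : ∑ v, (if v ∈ B then 1 else 0 : ℤ) = B.card := by simp
  have hT : ∑ v, (q + 1 - (G.degree v : ℤ)) ≤ 2 * q - 2 := by
    rw [Finset.sum_sub_distrib, hsum, Finset.sum_const, Finset.card_univ, nsmul_eq_mul, hn]
    linarith
  have hb : (B.card : ℤ) ≤ 2 * q - 2 + A.card := by
    have : (B.card : ℤ) ≤ ∑ v, (q + 1 - (G.degree v : ℤ)) + A.card := by
      rw [← cardA, ← cardB, ← Finset.sum_add_distrib]
      refine Finset.sum_le_sum fun v _ => ?_
      have := hΔ v
      simp only [memA, memB]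
      split_ifs <;> omega
    linarith
  -- Pointwise this says `(q + 1 - d)(q + 2 - d)` is at least 2 for `d ≤ q` and at least 0 for `d =
  -- q + 1, q + 2`.
  have upper : ∑ v, (G.degree v : ℤ) * (q + 1 - G.degree v) ≤
      (q + 2) * ∑ v, (q + 1 - (G.degree v : ℤ)) - 2 * B.card := by
    rw [← cardB, Finset.mul_sum, Finset.mul_sum, ← Finset.sum_sub_distrib]
    refine Finset.sum_le_sum fun v _ => ?_
    have := hΔ v
    simp only [memB]
    generalize (G.degree v : ℤ) = d at *
    split_ifs
    · nlinarith
    · obtain rfl | rfl : d = q + 1 ∨ d = q + 2 := by omega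
      · linarith
      · linarith
  -- The deficiencies of the neighbours of `v` sum to at least `q + 1` if `v ∈ A`, to at least 2 if
  -- `d(v) = q + 1` (by parity), and to at least `-|N(v) ∩ A|` if `v ∈ B`.
  have lower : 2 * (Fintype.card V : ℤ) + (q - 1) * A.card - 2 * B.card -
      ∑ w ∈ B, ((G.neighborFinset w ∩ A).card : ℤ) ≤
      ∑ v, ∑ w ∈ G.neighborFinset v, (q + 1 - (G.degree w : ℤ)) := by
    have e1 : ∑ w ∈ B, ((G.neighborFinset w ∩ A).card : ℤ) =
        ∑ w, if w ∈ B then ((G.neighborFinset w ∩ A).card : ℤ) else 0 := by simp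
    have e2 : 2 * (Fintype.card V : ℤ) = ∑ v : V, 2 := by simp [mul_comm]
    rw [e1, e2, ← cardA, ← cardB, Finset.mul_sum, Finset.mul_sum, ← Finset.sum_add_distrib,
      ← Finset.sum_sub_distrib, ← Finset.sum_sub_distrib]
    refine Finset.sum_le_sum fun v _ => ?_
    have e3 : ∑ w ∈ G.neighborFinset v, (q + 1 - (G.degree w : ℤ)) =
        q * G.degree v - ∑ w ∈ G.neighborFinset v, ((G.degree w : ℤ) - 1) := by
      rw [← card_neighborFinset_eq_degree, mul_comm, ← nsmul_eq_mul, ← Finset.sum_const,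
        ← Finset.sum_sub_distrib]
      exact Finset.sum_congr rfl fun w _ => by ring
    have hv := hΔ v
    by_cases hvB : v ∈ B
    · have hvA : v ∉ A := by
        rw [memA]
        have := (memB v).1 hvB
        omega
      rw [if_pos hvB, if_pos hvB, if_neg hvA]
      have : -((G.neighborFinset v ∩ A).card : ℤ) ≤
          ∑ w ∈ G.neighborFinset v, (q + 1 - (G.degree w : ℤ)) := by
        have e4 : -((G.neighborFinset v ∩ A).card : ℤ) =
            ∑ w ∈ G.neighborFinset v, (if w ∈ A then -1 else 0 : ℤ) := by
          rw [← Finset.sum_filter, Finset.filter_mem_eq_inter]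
          simp
        rw [e4]
        refine Finset.sum_le_sum fun w _ => ?_
        have := hΔ w
        simp only [memA]
        split_ifs <;> omega
      linarith
    · rw [if_neg hvB, if_neg hvB, e3]
      by_cases hvA : v ∈ A
      · rw [if_pos hvA, (memA v).1 hvA]
        have := h.sum_degree_sub_one_le v
        rw [hn] at this
        linarith
      · have hd : (G.degree v : ℤ) = q + 1 := by
          rw [memA] at hvA
          rw [memB] at hvB
          omega
        have hodd : Odd (G.degree v) := by
          rw [← Int.odd_coe_nat, hd]
          exact hqe.add_one
        rw [if_neg hvA, hd]
        have := h.sum_degree_sub_one_le_of_odd hodd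
        rw [hn] at this
        linarith
  rw [sum_sum_neighborFinset] at lower
  refine incidence_bounds_contradiction hq (Int.natCast_nonneg A.card) (fun hpos => ?_) hb
    (I := ∑ w ∈ B, ((G.neighborFinset w ∩ A).card : ℤ)) ?_ ?_ (h.sq_incidences_le A B)
  · exact h.card_degree_eq_le (by omega) hn he (fun y => (memA y).1)
      (Finset.card_pos.1 (by exact_mod_cast hpos))
  -- The constant 4 is `2(q² + q) - (q + 2)(2q - 2)`.
  · rw [hn] at lower
    linarith [mul_le_mul_of_nonneg_left hT (show 0 ≤ q + 2 by omega)]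
  · exact sum_card_neighborFinset_inter_le A B fun v hv => ((memA v).1 hv).le

end

theorem extremalNumber_cycleGraph_four_le (q : ℕ) (hq : Even q) :
    (extremalNumber (q ^ 2 + q) (cycleGraph 4) : ℚ) ≤ 1 / 2 * q * (q + 1) ^ 2 - q := by
  have key : 2 * extremalNumber (q ^ 2 + q) (cycleGraph 4) + 2 * q ≤ q * (q + 1) ^ 2 := by
    rcases Nat.eq_zero_or_pos q with rfl | hpos
    · have : extremalNumber (0 ^ 2 + 0) (cycleGraph 4) ≤ 0 := by
        rw [← Fintype.card_fin (0 ^ 2 + 0), extremalNumber_le_iff]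
        intro G _ _
        simp [Finset.eq_empty_of_isEmpty]
      omega
    · have h2 : 2 ≤ q := by
        obtain ⟨r, rfl⟩ := hq
        omega
      have : extremalNumber (q ^ 2 + q) (cycleGraph 4) ≤ (q * (q + 1) ^ 2 - 2 * q) / 2 := by
        conv_lhs => rw [← Fintype.card_fin (q ^ 2 + q)]
        rw [extremalNumber_le_iff]
        intro G _ hG
        have := ((cycleGraph_four_free_iff G).1 hG).two_mul_card_edgeFinset_le (q := q)
          (by exact_mod_cast h2) (by exact_mod_cast hq) (by simp)
        have : 2 * G.edgeFinset.card + 2 * q ≤ q * (q + 1) ^ 2 := by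
          zify
          linarith
        omega
      -- Ensures that the natural-number subtraction above is not truncated.
      have h3 : 2 * q ≤ q * (q + 1) ^ 2 := by nlinarith
      omega
  have : (2 * extremalNumber (q ^ 2 + q) (cycleGraph 4) + 2 * q : ℚ) ≤ q * (q + 1) ^ 2 := by
    exact_mod_cast key
  linarith

end SimpleGraph

/-! ### Orthogonal polarity graphs. -/

namespace Polarity

open Configuration

section

variable {P L : Type*} [Membership P L] (φ : Polarity P L)

theorem atMostOneCommonNeighbor_graph [Nondegenerate P L] :
    φ.graph.AtMostOneCommonNeighbor := by
  intro s t a b hst has hat hbs hbt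
  exact (Nondegenerate.eq_or_eq has.2 hbs.2 hat.2 hbt.2).resolve_right
    fun e => hst (φ.toLine.injective e)

end

variable {P L : Type*} [Fintype P] [Fintype L] [Membership P L] [ProjectivePlane P L]
  (φ : Polarity P L) [DecidableRel φ.graph.Adj]

-- The polar line of `y` has `q + 1` points; if `y` is absolute it is one of them, and loops are
-- excluded.
open Classical in
theorem degree_graph_add (y : P) :
    φ.graph.degree y + (if φ.IsAbsolute y then 1 else 0) = ProjectivePlane.order P L + 1 := by
  rw [← ProjectivePlane.pointCount_eq P (φ.toLine y), pointCount, Nat.card_eq_fintype_card,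
    Fintype.card_subtype, ← SimpleGraph.card_neighborFinset_eq_degree]
  have e : φ.graph.neighborFinset y = ({x | x ∈ φ.toLine y} : Finset P).erase y := by
    ext x
    rw [SimpleGraph.mem_neighborFinset, SimpleGraph.adj_comm]
    simp [graph]
  rw [e]
  split_ifs with h
  · exact Finset.card_erase_add_one (by simpa [IsAbsolute] using h)
  · rw [Finset.erase_eq_of_notMem (by simpa [IsAbsolute] using h), add_zero]

variable {φ}

theorem IsOrthogonal.two_mul_card_edgeFinset (h : φ.IsOrthogonal) :
    2 * φ.graph.edgeFinset.card =
      ProjectivePlane.order P L * (ProjectivePlane.order P L + 1) ^ 2 := by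
  classical
  have hsum := Finset.sum_congr (rfl : (Finset.univ : Finset P) = _)
    fun y _ => φ.degree_graph_add y
  rw [Finset.sum_add_distrib, φ.graph.sum_degrees_eq_twice_card_edges, Finset.sum_const,
    Finset.card_univ, ProjectivePlane.card_points P L, Finset.sum_boole, smul_eq_mul] at hsum
  have hcard : ({y | φ.IsAbsolute y} : Finset P).card = ProjectivePlane.order P L + 1 := by
    rw [← h, Set.ncard_eq_toFinset_card', Set.toFinset_ofPred]
  rw [Nat.cast_id, hcard] at hsum
  linarith

theorem IsOrthogonal.minDegree_graph (h : φ.IsOrthogonal) :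
    φ.graph.minDegree = ProjectivePlane.order P L := by
  classical
  obtain ⟨p, hp⟩ : {p : P | φ.IsAbsolute p}.Nonempty := by
    rw [← Set.ncard_pos, h]
    omega
  have : Nonempty P := ⟨p⟩
  refine le_antisymm ?_ (φ.graph.le_minDegree_of_forall_le_degree _ fun v => ?_)
  · have := φ.degree_graph_add p
    rw [if_pos (show φ.IsAbsolute p from hp)] at this
    have := φ.graph.minDegree_le_degree p
    omega
  · have := φ.degree_graph_add v
    split_ifs at this <;> omega

theorem IsOrthogonal.card_compl_and_free_and_card_edgeFinset [DecidableEq P]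
    (h : φ.IsOrthogonal) {v : P} (hv : φ.graph.degree v = φ.graph.minDegree) :
    Fintype.card ({v}ᶜ : Set P) = ProjectivePlane.order P L ^ 2 + ProjectivePlane.order P L ∧
    (SimpleGraph.cycleGraph 4).Free (φ.graph.induce {v}ᶜ) ∧
    ((φ.graph.induce {v}ᶜ).edgeFinset.card : ℚ) =
      1 / 2 * ProjectivePlane.order P L * (ProjectivePlane.order P L + 1) ^ 2 -
        ProjectivePlane.order P L := by
  refine ⟨?_, ?_, ?_⟩
  · rw [Fintype.card_compl_set, ProjectivePlane.card_points P L, Fintype.card_unique,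
      Nat.add_sub_cancel]
  · intro hc
    exact (SimpleGraph.cycleGraph_four_free_iff _).2 φ.atMostOneCommonNeighbor_graph
      (hc.trans (SimpleGraph.Embedding.induce _).isContained)
  · have h1 : (φ.graph.induce {v}ᶜ).edgeFinset.card + φ.graph.degree v =
        φ.graph.edgeFinset.card := by
      have h2 := φ.graph.card_edgeFinset_induce_compl_singleton v
      have h3 := φ.graph.card_edgeFinset_deleteIncidenceSet v
      have h4 : φ.graph.degree v ≤ φ.graph.edgeFinset.card := by
        rw [← SimpleGraph.card_incidenceFinset_eq_degree]
        exact Finset.card_le_card (φ.graph.incidenceFinset_subset v)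
      rw [h2, h3]
      omega
    have h5 := h.two_mul_card_edgeFinset
    rw [hv, h.minDegree_graph] at h1
    rw [← h1] at h5
    have h6 : (2 * ((φ.graph.induce {v}ᶜ).edgeFinset.card + ProjectivePlane.order P L) : ℚ) =
        ProjectivePlane.order P L * (ProjectivePlane.order P L + 1) ^ 2 := by
      exact_mod_cast h5
    linarith

theorem IsOrthogonal.card_edgeFinset_eq_extremalNumber [DecidableEq P]
    (h : φ.IsOrthogonal) {v : P} (hv : φ.graph.degree v = φ.graph.minDegree)
    (hq : Even (ProjectivePlane.order P L)) :
    (φ.graph.induce {v}ᶜ).edgeFinset.card = SimpleGraph.extremalNumber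
      (ProjectivePlane.order P L ^ 2 + ProjectivePlane.order P L) (SimpleGraph.cycleGraph 4) := by
  obtain ⟨h1, h2, h3⟩ := h.card_compl_and_free_and_card_edgeFinset hv
  refine le_antisymm (h1 ▸ SimpleGraph.card_edgeFinset_le_extremalNumber h2) ?_
  have := SimpleGraph.extremalNumber_cycleGraph_four_le _ hq
  rw [← h3] at this
  exact_mod_cast this

end Polarity

/-! ### An orthogonal polarity in characteristic two. -/

namespace Configuration.ofField

open scoped LinearAlgebra.Projectivization

open Projectivization Matrix

/-- The polarity of the projective plane over a field given by the standard dot product. -/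
def dotPolarity (K : Type*) [Field K] [DecidableEq K] :
    Polarity (ℙ K (Fin 3 → K)) (ℙ K (Fin 3 → K)) where
  toLine := Equiv.refl _
  mem_iff p l := by
    rw [mem_iff, Equiv.refl_symm, Equiv.refl_apply, Equiv.refl_apply, mem_iff, orthogonal_comm]

variable (K : Type*) [Field K] [DecidableEq K] [Finite K]

theorem order_eq_card :
    ProjectivePlane.order (ℙ K (Fin 3 → K)) (ℙ K (Fin 3 → K)) = Nat.card K := by
  have : Fintype (ℙ K (Fin 3 → K)) := Fintype.ofFinite _
  have h1 := ProjectivePlane.card_points (ℙ K (Fin 3 → K)) (ℙ K (Fin 3 → K))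
  have h2 := card_of_finrank K (Fin 3 → K) (n := 3) (by simp)
  rw [← Nat.card_eq_fintype_card, h2] at h1
  simp only [Finset.sum_range_succ, Finset.sum_range_zero, pow_zero, pow_one] at h1
  generalize ProjectivePlane.order (ℙ K (Fin 3 → K)) (ℙ K (Fin 3 → K)) = a at *
  nlinarith

/-- In characteristic two the absolute points of the dot product polarity form a line. -/
theorem isOrthogonal_dotPolarity [CharP K 2] : (dotPolarity K).IsOrthogonal := by
  have hne : (![1, 1, 1] : Fin 3 → K) ≠ 0 := fun h => one_ne_zero (congr_fun h 0)
  rw [Polarity.IsOrthogonal,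
    ← ProjectivePlane.pointCount_eq (ℙ K (Fin 3 → K)) (L := ℙ K (Fin 3 → K))
      (Projectivization.mk K ![1, 1, 1] hne),
    pointCount, ← Nat.card_coe_set_eq]
  refine Nat.card_congr (Equiv.subtypeEquivRight fun p => ?_)
  induction p with | h v hv =>
  change orthogonal (Projectivization.mk K v hv) (Projectivization.mk K v hv) ↔
    orthogonal (Projectivization.mk K v hv) (Projectivization.mk K ![1, 1, 1] hne)
  rw [orthogonal_mk, orthogonal_mk]
  -- Squaring is additive in characteristic two.
  have : v ⬝ᵥ v = (v ⬝ᵥ ![1, 1, 1]) ^ 2 := by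
    simp [dotProduct, Fin.sum_univ_three, sq, CharTwo.add_mul_self]
  rw [this, sq_eq_zero_iff]

end Configuration.ofField

theorem theorem1 :
    -- the upper bound for even `q`
    (∀ q : ℕ, Even q →
      (SimpleGraph.extremalNumber (q ^ 2 + q) (SimpleGraph.cycleGraph 4) : ℚ)
        ≤ 1 / 2 * q * (q + 1) ^ 2 - q) ∧
    -- deleting a vertex of minimum degree from an orthogonal polarity graph
    (∀ (P L : Type*) [Fintype P] [Fintype L] [DecidableEq P] [Membership P L]
      [Configuration.ProjectivePlane P L] (φ : Polarity P L) [DecidableRel φ.graph.Adj]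
      (q : ℕ) (v : P),
      Configuration.ProjectivePlane.order P L = q → φ.IsOrthogonal →
      φ.graph.degree v = φ.graph.minDegree →
        Fintype.card ({v}ᶜ : Set P) = q ^ 2 + q ∧
        (SimpleGraph.cycleGraph 4).Free (φ.graph.induce {v}ᶜ) ∧
        ((φ.graph.induce {v}ᶜ).edgeFinset.card : ℚ) = 1 / 2 * q * (q + 1) ^ 2 - q ∧
        (Even q → (φ.graph.induce {v}ᶜ).edgeFinset.card =
          SimpleGraph.extremalNumber (q ^ 2 + q) (SimpleGraph.cycleGraph 4))) ∧
    -- equality when `q` is a power of two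
    (∀ q k : ℕ, q = 2 ^ k →
      (SimpleGraph.extremalNumber (q ^ 2 + q) (SimpleGraph.cycleGraph 4) : ℚ)
        = 1 / 2 * q * (q + 1) ^ 2 - q) := by
  refine ⟨SimpleGraph.extremalNumber_cycleGraph_four_le, ?_, ?_⟩
  · rintro P L _ _ _ _ _ φ _ q v rfl h hv
    obtain ⟨h1, h2, h3⟩ := h.card_compl_and_free_and_card_edgeFinset hv
    exact ⟨h1, h2, h3, h.card_edgeFinset_eq_extremalNumber hv⟩
  · rintro q k rfl
    -- No field has order `q = 1`, so `k = 0` is checked directly on two vertices.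
    rcases Nat.eq_zero_or_pos k with rfl | hk
    · have : SimpleGraph.extremalNumber 2 (SimpleGraph.cycleGraph 4) = 1 := by
        refine le_antisymm ?_ ?_
        · rw [← Fintype.card_fin 2, SimpleGraph.extremalNumber_le_iff]
          intro G _ _
          exact G.card_edgeFinset_le_card_choose_two.trans (by simp)
        · have hfree : (SimpleGraph.cycleGraph 4).Free (⊤ : SimpleGraph (Fin 2)) := by
            rintro ⟨f⟩
            simpa using Fintype.card_le_of_injective f f.injective
          have := SimpleGraph.card_edgeFinset_le_extremalNumber hfree
          rwa [SimpleGraph.card_edgeFinset_top_eq_card_choose_two, Fintype.card_fin] at this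
      norm_num [this]
    · classical
      have : Fact (Nat.Prime 2) := ⟨Nat.prime_two⟩
      let K := GaloisField 2 k
      have hKcard : Nat.card K = 2 ^ k := GaloisField.card 2 k hk.ne'
      let plane := Projectivization K (Fin 3 → K)
      have : Fintype plane := Fintype.ofFinite _
      have h := Configuration.ofField.isOrthogonal_dotPolarity K
      have : Nonempty plane := ⟨(Configuration.ProjectivePlane.exists_config
        (P := plane) (L := plane)).choose⟩
      obtain ⟨v, hv⟩ := (Configuration.ofField.dotPolarity K).graph.exists_minimal_degree_vertex
      have horder := (Configuration.ofField.order_eq_card K).trans hKcard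
      have hcard := (h.card_compl_and_free_and_card_edgeFinset hv.symm).2.2
      rw [h.card_edgeFinset_eq_extremalNumber hv.symm
        (horder ▸ (even_two.pow_of_ne_zero hk.ne'))] at hcard
      rwa [horder] at hcard
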